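/- For probability measures $\mu,\nu$ on $\mathbb{R}^d$ let $W_2^2(\mu,\nu)=\inf_{\pi}\int\|x-y\|_2^2\,d\pi(x,y)\in[0,\infty]$, the infimum being over all couplings $\pi$ of $\mu$ and $\nu$; a coupling attaining it is called an optimal plan. For $t\in[0,1]$ put $P_t(x,y)=(1-t)x+ty$; the McCann interpolation given by an optimal plan $\pi$ is $((P_t)_\#\pi)_{t\in[0,1]}$. All pairs of measures below are pairs of probability measures at finite $W_2$ distance (for instance with finite second moments). Let $\mu\neq\nu$ be such a pair and let $\pi$ be an optimal plan between them. Let $M(\mu,\nu)$ be the set of such pairs $(\tilde\mu,\tilde\nu)$ having an optimal plan $\tilde\pi$ whose McCann interpolation contains that of $\pi$: there is an interval $[a,b]\subset[0,1]$ such that for every $t\in[0,1]$ there is $s\in[a,b]$ with $(P_s)_\#\tilde\pi=(P_t)_\#\pi$. Let $t\in[0,1]$ and $\mu_t=(P_t)_\#\pi$, and consider the problem of minimizing $$(1-s)\,W_2^2(\tilde\mu,\mu_t)+s\,W_2^2(\tilde\nu,\mu_t)$$ over all $(\tilde\mu,\tilde\nu)\in M(\mu,\nu)$, with associated optimal plan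 $\tilde\pi$ as above, and all $s\in[0,1]$ such that $(P_s)_\#\tilde\pi=\mu_t$. Then: 1. For every $t\in[0,1]$, the pair $(\mu,\nu)$ with $s=t$ is admissible and is a minimizer. 2. For every $t\in(0,1)$, the minimizer is unique up to exchanging the two measures: the minimizers are exactly $(\mu,\nu)$ with $s=t$ and $(\nu,\mu)$ with $s=1-t$. -/

import Mathlib

open MeasureTheory Set
open scoped ENNReal

namespace McCann

/-- The Euclidean space `ℝ^d`. -/
abbrev Rd (d : ℕ) : Type := EuclideanSpace ℝ (Fin d)

/-- `π` is a coupling of `μ` and `ν`: its marginals are `μ` and `ν`. -/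
def IsCoupling {d : ℕ} (π : Measure (Rd d × Rd d)) (μ ν : Measure (Rd d)) : Prop :=
  π.fst = μ ∧ π.snd = ν

/-- The quadratic cost `∫ ‖x - y‖² dπ(x, y)`, with values in `[0, ∞]`. -/
noncomputable def cost {d : ℕ} (π : Measure (Rd d × Rd d)) : ℝ≥0∞ :=
  ∫⁻ p, ‖p.1 - p.2‖ₑ ^ 2 ∂π

/-- The squared Wasserstein-2 distance, with values in `[0, ∞]`. -/
noncomputable def W2sq {d : ℕ} (μ ν : Measure (Rd d)) : ℝ≥0∞ :=
  ⨅ (π : Measure (Rd d × Rd d)) (_ : IsCoupling π μ ν), cost π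

/-- `π` is an optimal transport plan between `μ` and `ν`. -/
def IsOptimalPlan {d : ℕ} (π : Measure (Rd d × Rd d)) (μ ν : Measure (Rd d)) : Prop :=
  IsCoupling π μ ν ∧ cost π = W2sq μ ν

/-- The map `P_t (x, y) = (1 - t) x + t y`. -/
def P {d : ℕ} (t : ℝ) (p : Rd d × Rd d) : Rd d :=
  (1 - t) • p.1 + t • p.2

/-- The point `(P_t)_# π` of the McCann interpolation given by the plan `π`. -/
noncomputable def interp {d : ℕ} (π : Measure (Rd d × Rd d)) (t : ℝ) : Measure (Rd d) :=
  π.map (P t)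

/-- The interpolation given by `π'` contains the one given by `π`. -/
def ContainsInterp {d : ℕ} (π' π : Measure (Rd d × Rd d)) : Prop :=
  ∃ a b : ℝ, 0 ≤ a ∧ a ≤ b ∧ b ≤ 1 ∧
    ∀ t ∈ Icc (0 : ℝ) 1, ∃ s ∈ Icc a b, interp π' s = interp π t

/-- The pair `(μ', ν')` of probability measures, at finite Wasserstein distance and with associated
optimal plan `π'`, contains the McCann interpolation given by `π`. -/
structure IsExtension {d : ℕ} (π : Measure (Rd d × Rd d)) (μ' ν' : Measure (Rd d))
    (π' : Measure (Rd d × Rd d)) : Prop where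
  prob_left : IsProbabilityMeasure μ'
  prob_right : IsProbabilityMeasure ν'
  finite : W2sq μ' ν' < ∞
  optimal : IsOptimalPlan π' μ' ν'
  contains : ContainsInterp π' π

/-- The candidates `((μ', ν'), s)`: pairs whose McCann interpolation contains the one given by `π`,
together with a time `s` at which it passes through `(P_t)_# π`. -/
def candidates {d : ℕ} (π : Measure (Rd d × Rd d)) (t : ℝ) :
    Set ((Measure (Rd d) × Measure (Rd d)) × ℝ) :=
  {q | ∃ π', IsExtension π q.1.1 q.1.2 π' ∧ q.2 ∈ Icc (0 : ℝ) 1 ∧ interp π' q.2 = interp π t}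

/-- The geometric sparse regularizer `(1 - s) W₂²(μ', ρ) + s W₂²(ν', ρ)` at `((μ', ν'), s)`. -/
noncomputable def regularizer {d : ℕ} (ρ : Measure (Rd d))
    (q : (Measure (Rd d) × Measure (Rd d)) × ℝ) : ℝ≥0∞ :=
  ENNReal.ofReal (1 - q.2) * W2sq q.1.1 ρ + ENNReal.ofReal q.2 * W2sq q.1.2 ρ

/-- The set of minimizers of `f` over `S`. -/
def argminSet {α : Type*} (f : α → ℝ≥0∞) (S : Set α) : Set α :=
  {q | q ∈ S ∧ ∀ q' ∈ S, f q ≤ f q'}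

end McCann

/-!
The interpolation of an optimal plan is a constant speed geodesic for the Wasserstein distance:
`W₂(μ_s, μ_t) = |t - s| W₂(μ, ν)` (`McCann.IsOptimalPlan.W2_interp`). The upper bound comes from
the coupling `(P_s, P_t)_# π`, the lower bound from the triangle inequality along
`μ, μ_s, μ_t, ν`. The triangle inequality (`McCann.W2_le_add`) is proved by gluing two couplings
along their common marginal (`McCann.exists_gluing`) and applying Minkowski's inequality.

Hence the regularizer of an extension `(μ', ν')`, at a time `s` when it passes through `μ_t`, equals
`s (1 - s) D'²` with `D' = W₂(μ', ν')` (`McCann.IsOptimalPlan.regularizer_eq`), and that of `(μ, ν)`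
at time `t` equals `t (1 - t) D²` with `D = W₂(μ, ν) > 0`. Let the extension pass through `μ`, `ν`
at the times `α`, `β`. Since both interpolations are geodesics, the points `α D'`, `s D'`, `β D'`
of the segment `[0, D']` have the same mutual distances as `0`, `t D`, `D`. So the two distances
`s D'` and `(1 - s) D'` from `s D'` to the ends of the segment are at least `t D` and `(1 - t) D`,
up to order, and their product is at least `t (1 - t) D²`. For `0 < t < 1` equality forces
`{α, β} = {0, 1}` (`McCann.mul_le_mul_of_geodesic`), so that `(μ', ν')` is `(μ, ν)` or `(ν, μ)`.
-/

namespace McCann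

variable {d : ℕ}

/-! ### The Wasserstein distance -/

/-- Gluing lemma: the conditional law of the third coordinate given the second is taken from `π₂`,
and does not depend on the first coordinate. -/
theorem exists_gluing {α β γ : Type*} [MeasurableSpace α] [MeasurableSpace β] [MeasurableSpace γ]
    [StandardBorelSpace γ] [Nonempty γ] (π₁ : Measure (α × β)) (π₂ : Measure (β × γ))
    [SFinite π₁] [IsFiniteMeasure π₂] (h : π₁.snd = π₂.fst) :
    ∃ σ : Measure ((α × β) × γ), σ.map Prod.fst = π₁ ∧ σ.map (fun q ↦ (q.1.2, q.2)) = π₂ := by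
  refine ⟨π₁.compProd (π₂.condKernel.comap Prod.snd measurable_snd), ?_, ?_⟩
  · exact Measure.fst_compProd _ _
  · ext s hs
    rw [Measure.map_apply (by fun_prop) hs,
      Measure.compProd_apply (hs.preimage (by fun_prop))]
    conv_rhs => rw [← π₂.disintegrate π₂.condKernel, Measure.compProd_apply hs, ← h, Measure.snd,
      lintegral_map (ProbabilityTheory.Kernel.measurable_kernel_prodMk_left hs) measurable_snd]
    rfl

theorem IsCoupling.isProbabilityMeasure {π : Measure (Rd d × Rd d)} {μ ν : Measure (Rd d)}
    [IsProbabilityMeasure μ] (h : IsCoupling π μ ν) : IsProbabilityMeasure π := by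
  refine ⟨?_⟩
  rw [← Measure.fst_univ, h.1, measure_univ]

/-- The Wasserstein-2 distance, with values in `[0, ∞]`. The square root is taken inside the
infimum, see `W2_sq`. -/
noncomputable def W2 (μ ν : Measure (Rd d)) : ℝ≥0∞ :=
  ⨅ (π : Measure (Rd d × Rd d)) (_ : IsCoupling π μ ν), cost π ^ (1 / 2 : ℝ)

theorem W2_eq (μ ν : Measure (Rd d)) : W2 μ ν = W2sq μ ν ^ (1 / 2 : ℝ) := by
  have h := (ENNReal.orderIsoRpow (1 / 2) (by norm_num)).map_iInf
    (fun π : Measure (Rd d × Rd d) ↦ ⨅ _ : IsCoupling π μ ν, cost π)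
  rw [ENNReal.orderIsoRpow_apply] at h
  rw [W2, W2sq, h]
  exact iInf_congr fun π ↦ ((ENNReal.orderIsoRpow (1 / 2) (by norm_num)).map_iInf
    (fun _ : IsCoupling π μ ν ↦ cost π)).symm

theorem W2_sq (μ ν : Measure (Rd d)) : W2 μ ν ^ 2 = W2sq μ ν := by
  rw [W2_eq, ← ENNReal.rpow_natCast, ← ENNReal.rpow_mul]
  norm_num

theorem IsCoupling.W2_le {π : Measure (Rd d × Rd d)} {μ ν : Measure (Rd d)}
    (h : IsCoupling π μ ν) : W2 μ ν ≤ cost π ^ (1 / 2 : ℝ) :=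
  iInf₂_le π h

theorem IsCoupling.swap {π : Measure (Rd d × Rd d)} {μ ν : Measure (Rd d)}
    (h : IsCoupling π μ ν) : IsCoupling (π.map Prod.swap) ν μ := by
  refine ⟨?_, ?_⟩
  · rw [Measure.fst_map_swap, h.2]
  · rw [Measure.snd_map_swap, h.1]

theorem measurable_cost_integrand :
    Measurable fun p : Rd d × Rd d ↦ ‖p.1 - p.2‖ₑ ^ 2 := by
  fun_prop

theorem cost_map {α : Type*} [MeasurableSpace α] (σ : Measure α) {f : α → Rd d × Rd d}
    (hf : Measurable f) : cost (σ.map f) = ∫⁻ a, ‖(f a).1 - (f a).2‖ₑ ^ 2 ∂σ :=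
  lintegral_map measurable_cost_integrand hf

theorem cost_swap (π : Measure (Rd d × Rd d)) : cost (π.map Prod.swap) = cost π := by
  rw [cost_map π measurable_swap]
  simp only [Prod.fst_swap, Prod.snd_swap, cost]
  congr! 3 with p
  rw [← enorm_neg, neg_sub]

theorem W2sq_comm (μ ν : Measure (Rd d)) : W2sq μ ν = W2sq ν μ := by
  have key (μ ν : Measure (Rd d)) : W2sq μ ν ≤ W2sq ν μ :=
    by
    refine le_iInf₂ fun π h ↦ ?_
    rw [← cost_swap π]
    exact iInf₂_le (π.map Prod.swap) h.swap
  exact (key μ ν).antisymm (key ν μ)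

theorem W2_comm (μ ν : Measure (Rd d)) : W2 μ ν = W2 ν μ := by
  rw [W2_eq, W2_eq, W2sq_comm]

/-- The triangle inequality for the Wasserstein distance. -/
theorem W2_le_add (μ ν ρ : Measure (Rd d)) [IsProbabilityMeasure μ] [IsProbabilityMeasure ν] :
    W2 μ ρ ≤ W2 μ ν + W2 ν ρ := by
  have key (π₁ π₂ : Measure (Rd d × Rd d)) (h₁ : IsCoupling π₁ μ ν) (h₂ : IsCoupling π₂ ν ρ) :
      W2 μ ρ ≤ cost π₁ ^ (1 / 2 : ℝ) + cost π₂ ^ (1 / 2 : ℝ) := by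
    have := h₁.isProbabilityMeasure
    have := h₂.isProbabilityMeasure
    obtain ⟨σ, hσ₁, hσ₂⟩ := exists_gluing π₁ π₂ (h₁.2.trans h₂.1.symm)
    have hm : Measurable fun q : (Rd d × Rd d) × Rd d ↦ (q.1.1, q.2) := by fun_prop
    have hm' : Measurable fun q : (Rd d × Rd d) × Rd d ↦ (q.1.2, q.2) := by fun_prop
    have hc : IsCoupling (σ.map fun q ↦ (q.1.1, q.2)) μ ρ := by
      constructor
      · rw [← h₁.1, ← hσ₁, Measure.fst, Measure.fst, Measure.map_map measurable_fst hm,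
          Measure.map_map measurable_fst measurable_fst]
        rfl
      · rw [← h₂.2, ← hσ₂, Measure.snd, Measure.snd, Measure.map_map measurable_snd hm,
          Measure.map_map measurable_snd hm']
        rfl
    refine hc.W2_le.trans ?_
    rw [← hσ₁, ← hσ₂, cost_map σ hm, cost_map σ measurable_fst, cost_map σ hm']
    have hM := ENNReal.lintegral_Lp_add_le (μ := σ) (p := 2)
      (f := fun q ↦ ‖q.1.1 - q.1.2‖ₑ) (g := fun q ↦ ‖q.1.2 - q.2‖ₑ)
      (by fun_prop) (by fun_prop) (by norm_num)
    simp only [ENNReal.rpow_two, Pi.add_apply] at hM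
    refine le_trans ?_ hM
    gcongr with q
    exact (congrArg _ (sub_add_sub_cancel q.1.1 q.1.2 q.2).symm).trans_le (enorm_add_le _ _)
  have h (π₁ : Measure (Rd d × Rd d)) (h₁ : IsCoupling π₁ μ ν) :
      W2 μ ρ ≤ cost π₁ ^ (1 / 2 : ℝ) + W2 ν ρ := by
    rw [← tsub_le_iff_left]
    exact le_iInf₂ fun π₂ h₂ ↦ tsub_le_iff_left.2 (key π₁ π₂ h₁ h₂)
  rw [← tsub_le_iff_right]
  exact le_iInf₂ fun π₁ h₁ ↦ tsub_le_iff_right.2 (h π₁ h₁)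

/-! ### The McCann interpolation is a geodesic -/

theorem measurable_P (t : ℝ) : Measurable (P (d := d) t) := by
  unfold P
  fun_prop

theorem IsCoupling.interp_zero {π : Measure (Rd d × Rd d)} {μ ν : Measure (Rd d)}
    (h : IsCoupling π μ ν) : interp π 0 = μ := by
  rw [← h.1, interp, Measure.fst]
  congr! 1
  ext p : 1
  simp [P]

theorem IsCoupling.interp_one {π : Measure (Rd d × Rd d)} {μ ν : Measure (Rd d)}
    (h : IsCoupling π μ ν) : interp π 1 = ν := by
  rw [← h.2, interp, Measure.snd]
  congr! 1
  ext p : 1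
  simp [P]

theorem interp_swap (π : Measure (Rd d × Rd d)) (t : ℝ) :
    interp (π.map Prod.swap) t = interp π (1 - t) := by
  rw [interp, interp, Measure.map_map (measurable_P t) measurable_swap]
  congr 1
  ext p : 1
  simp [P, add_comm]

instance (π : Measure (Rd d × Rd d)) [IsProbabilityMeasure π] (t : ℝ) :
    IsProbabilityMeasure (interp π t) :=
  Measure.isProbabilityMeasure_map (measurable_P t).aemeasurable

/-- Two points of an interpolation are coupled by moving along the segments of the plan. -/
theorem isCoupling_interp (π : Measure (Rd d × Rd d)) (s t : ℝ) :
    IsCoupling (π.map fun p ↦ (P s p, P t p)) (interp π s) (interp π t) :=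
  ⟨Measure.fst_map_prodMk (measurable_P t), Measure.snd_map_prodMk (measurable_P s)⟩

theorem W2_interp_le (π : Measure (Rd d × Rd d)) (s t : ℝ) :
    W2 (interp π s) (interp π t) ≤ ENNReal.ofReal |t - s| * cost π ^ (1 / 2 : ℝ) := by
  refine (isCoupling_interp π s t).W2_le.trans_eq ?_
  have h (p : Rd d × Rd d) :
      ‖P s p - P t p‖ₑ ^ 2 = ENNReal.ofReal |t - s| ^ 2 * ‖p.1 - p.2‖ₑ ^ 2 := by
    have : P s p - P t p = (t - s) • (p.1 - p.2) := by
      simp only [P]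
      module
    rw [this, enorm_smul, mul_pow, ← ofReal_norm (t - s), Real.norm_eq_abs]
  rw [cost_map π ((measurable_P s).prodMk (measurable_P t))]
  simp only [h]
  rw [lintegral_const_mul _ measurable_cost_integrand, ENNReal.mul_rpow_of_nonneg _ _ (by norm_num),
    ← ENNReal.rpow_natCast, ← ENNReal.rpow_mul]
  norm_num [cost]

theorem IsOptimalPlan.cost_rpow {π : Measure (Rd d × Rd d)} {μ ν : Measure (Rd d)}
    (h : IsOptimalPlan π μ ν) : cost π ^ (1 / 2 : ℝ) = W2 μ ν := by
  rw [h.2, W2_eq]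

theorem W2_ne_top {μ ν : Measure (Rd d)} (h : W2sq μ ν < ∞) : W2 μ ν ≠ ∞ := by
  rw [W2_eq]
  exact ENNReal.rpow_ne_top_of_nonneg (by norm_num) h.ne

/-- The interpolation given by an optimal plan of finite cost is a constant speed geodesic. -/
theorem IsOptimalPlan.W2_interp {π : Measure (Rd d × Rd d)} {μ ν : Measure (Rd d)}
    [IsProbabilityMeasure μ] (h : IsOptimalPlan π μ ν) (hfin : W2sq μ ν < ∞) {s t : ℝ}
    (hs : s ∈ Icc (0 : ℝ) 1) (ht : t ∈ Icc (0 : ℝ) 1) :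
    W2 (interp π s) (interp π t) = ENNReal.ofReal (|t - s| * (W2 μ ν).toReal) := by
  have hD := W2_ne_top hfin
  have hle (s t : ℝ) :
      W2 (interp π s) (interp π t) ≤ ENNReal.ofReal (|t - s| * (W2 μ ν).toReal) := by
    rw [ENNReal.ofReal_mul (abs_nonneg _), ENNReal.ofReal_toReal hD, ← h.cost_rpow]
    exact W2_interp_le π s t
  refine (hle s t).antisymm ?_
  wlog hst : s ≤ t generalizing s t
  · rw [W2_comm (interp π s), abs_sub_comm]
    exact this ht hs (le_of_not_ge hst)
  have := h.1.isProbabilityMeasure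
  -- The triangle inequality gives `D ≤ s D + W₂(μ_s, μ_t) + (1 - t) D`.
  have h₁ := W2_le_add (interp π 0) (interp π s) (interp π 1)
  have h₂ := W2_le_add (interp π s) (interp π t) (interp π 1)
  have h₃ := (h₁.trans (add_le_add_right h₂ _)).trans
    (add_le_add (hle 0 s) (add_le_add_right (hle t 1) _))
  have hX : W2 (interp π s) (interp π t) ≠ ∞ := ((hle s t).trans_lt ENNReal.ofReal_lt_top).ne
  rw [h.1.interp_zero, h.1.interp_one, ← ENNReal.ofReal_toReal hX, ← ENNReal.ofReal_toReal hD,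
    ← ENNReal.ofReal_add (by positivity) (by positivity),
    ← ENNReal.ofReal_add (by positivity) (by positivity),
    ENNReal.ofReal_le_ofReal_iff (by positivity), ENNReal.toReal_ofReal (by positivity),
    abs_of_nonneg (by linarith [hs.1]), abs_of_nonneg (by linarith [ht.2])] at h₃
  rw [← ENNReal.ofReal_toReal hX, abs_of_nonneg (by linarith)]
  apply ENNReal.ofReal_le_ofReal
  linarith

theorem IsOptimalPlan.W2_ne_zero {π : Measure (Rd d × Rd d)} {μ ν : Measure (Rd d)}
    (h : IsOptimalPlan π μ ν) (hne : μ ≠ ν) : W2 μ ν ≠ 0 := by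
  contrapose! hne
  have h0 : cost π = 0 := by
    rw [h.2, ← W2_sq, hne]
    norm_num
  rw [cost, lintegral_eq_zero_iff measurable_cost_integrand] at h0
  rw [← h.1.1, ← h.1.2]
  refine Measure.map_congr ?_
  filter_upwards [h0] with p hp
  simpa [sub_eq_zero] using hp

/-! ### Comparing the regularizer along an extension -/

theorem IsOptimalPlan.regularizer_eq {π : Measure (Rd d × Rd d)} {μ ν : Measure (Rd d)}
    [IsProbabilityMeasure μ] (h : IsOptimalPlan π μ ν) (hfin : W2sq μ ν < ∞) {s : ℝ}
    (hs : s ∈ Icc (0 : ℝ) 1) :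
    regularizer (interp π s) ((μ, ν), s) =
      ENNReal.ofReal (s * (W2 μ ν).toReal * ((1 - s) * (W2 μ ν).toReal)) := by
  have h₀ := h.W2_interp hfin (left_mem_Icc.2 zero_le_one) hs
  have h₁ := h.W2_interp hfin (right_mem_Icc.2 zero_le_one) hs
  rw [h.1.interp_zero] at h₀
  rw [h.1.interp_one] at h₁
  have hs' : 0 ≤ 1 - s := sub_nonneg.2 hs.2
  simp only [regularizer]
  rw [← W2_sq, ← W2_sq, h₀, h₁, ← ENNReal.ofReal_pow (by positivity),
    ← ENNReal.ofReal_pow (by positivity), ← ENNReal.ofReal_mul hs', ← ENNReal.ofReal_mul hs.1,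
    ← ENNReal.ofReal_add (mul_nonneg hs' (by positivity)) (mul_nonneg hs.1 (by positivity)),
    mul_pow, mul_pow, sq_abs, sq_abs]
  congr 1
  ring

theorem IsOptimalPlan.isExtension_self {π : Measure (Rd d × Rd d)} {μ ν : Measure (Rd d)}
    [hμ : IsProbabilityMeasure μ] [hν : IsProbabilityMeasure ν] (h : IsOptimalPlan π μ ν)
    (hfin : W2sq μ ν < ∞) : IsExtension π μ ν π :=
  ⟨hμ, hν, hfin, h, 0, 1, le_rfl, zero_le_one, le_rfl, fun t ht ↦ ⟨t, ht, rfl⟩⟩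

theorem IsOptimalPlan.swap {π : Measure (Rd d × Rd d)} {μ ν : Measure (Rd d)}
    (h : IsOptimalPlan π μ ν) : IsOptimalPlan (π.map Prod.swap) ν μ :=
  ⟨h.1.swap, by rw [cost_swap, h.2, W2sq_comm]⟩

theorem IsOptimalPlan.isExtension_swap {π : Measure (Rd d × Rd d)} {μ ν : Measure (Rd d)}
    [hμ : IsProbabilityMeasure μ] [hν : IsProbabilityMeasure ν] (h : IsOptimalPlan π μ ν)
    (hfin : W2sq μ ν < ∞) : IsExtension π ν μ (π.map Prod.swap) :=
  ⟨hν, hμ, by rwa [W2sq_comm], h.swap, 0, 1, le_rfl, zero_le_one, le_rfl, fun t ht ↦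
    ⟨1 - t, ⟨by linarith [ht.2], by linarith [ht.1]⟩, by rw [interp_swap, sub_sub_cancel]⟩⟩

/-- Points `A`, `S`, `B` of `[0, D']` with the mutual distances of `0`, `t D`, `D` satisfy
`t D (1 - t) D ≤ S (D' - S)`; for `0 < t < 1`, equality holds only if `A` and `B` are the two ends
of the segment. -/
theorem mul_le_mul_of_geodesic {D D' t A B S : ℝ} (hD : 0 < D) (ht : t ∈ Icc (0 : ℝ) 1)
    (hA : A ∈ Icc 0 D') (hB : B ∈ Icc 0 D')
    (hAB : |B - A| = D) (hAS : |S - A| = t * D) (hSB : |B - S| = (1 - t) * D) :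
    t * D * ((1 - t) * D) ≤ S * (D' - S) ∧
      (0 < t → t < 1 → S * (D' - S) ≤ t * D * ((1 - t) * D) →
        D' = D ∧ (A = 0 ∧ B = D' ∧ S = t * D ∨ A = D' ∧ B = 0 ∧ S = (1 - t) * D)) := by
  -- The reflection `x ↦ D' - x` exchanges the two orientations.
  wlog h : A ≤ B generalizing A B S
  · have := this (A := D' - A) (B := D' - B) (S := D' - S)
      ⟨by linarith [hA.2], by linarith [hA.1]⟩ ⟨by linarith [hB.2], by linarith [hB.1]⟩
      (by rw [← hAB, abs_sub_comm]; congr 1; ring)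
      (by rw [← hAS, abs_sub_comm]; congr 1; ring)
      (by rw [← hSB, abs_sub_comm]; congr 1; ring) (by linarith)
    rw [sub_sub_cancel, mul_comm (D' - S)] at this
    refine ⟨this.1, fun h₀ h₁ hle ↦ ?_⟩
    obtain ⟨h₂, ⟨h₃, h₄, h₅⟩ | ⟨h₃, h₄, h₅⟩⟩ := this.2 h₀ h₁ hle
    · exact ⟨h₂, .inr ⟨by linarith, by linarith, by linarith⟩⟩
    · exact ⟨h₂, .inl ⟨by linarith, by linarith, by linarith⟩⟩
  rw [abs_of_nonneg (sub_nonneg.2 h)] at hAB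
  have htD : 0 ≤ t * D := mul_nonneg ht.1 hD.le
  have hS : S = A + t * D := by
    have := le_abs_self (B - S)
    have := le_abs_self (S - A)
    linarith
  have h₁ : t * D ≤ S := by linarith [hA.1]
  have h₂ : (1 - t) * D ≤ D' - S := by linarith [hB.2]
  have htD' : 0 ≤ (1 - t) * D := mul_nonneg (sub_nonneg.2 ht.2) hD.le
  refine ⟨mul_le_mul h₁ h₂ htD' (by linarith), fun h0 h1 hle ↦ ?_⟩
  have p₁ : 0 < t * D := mul_pos h0 hD
  have p₂ : 0 < (1 - t) * D := mul_pos (by linarith) hD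
  have hA0 : A = 0 := by
    have := hA.1
    nlinarith
  have hB0 : B = D' := by
    have := hB.2
    nlinarith
  exact ⟨by linarith, .inl ⟨hA0, hB0, by linarith⟩⟩

/-- An extension passing through `μ_t` at time `s` has a regularizer at least that of `(μ, ν)` at
time `t`; for `0 < t < 1`, equality holds only for `(μ, ν)` and its reversal. -/
theorem IsExtension.regularizer_compare {μ ν μ' ν' : Measure (Rd d)}
    {π π' : Measure (Rd d × Rd d)} [IsProbabilityMeasure μ] (hne : μ ≠ ν)
    (hfin : W2sq μ ν < ∞) (hπ : IsOptimalPlan π μ ν) (hπ' : IsExtension π μ' ν' π') {s t : ℝ}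
    (hs : s ∈ Icc (0 : ℝ) 1) (ht : t ∈ Icc (0 : ℝ) 1) (hst : interp π' s = interp π t) :
    regularizer (interp π t) ((μ, ν), t) ≤ regularizer (interp π t) ((μ', ν'), s) ∧
      (t ∈ Ioo (0 : ℝ) 1 →
        regularizer (interp π t) ((μ', ν'), s) ≤ regularizer (interp π t) ((μ, ν), t) →
        ((μ', ν'), s) = ((μ, ν), t) ∨ ((μ', ν'), s) = ((ν, μ), 1 - t)) := by
  have := hπ'.prob_left
  have hD : 0 < (W2 μ ν).toReal := ENNReal.toReal_pos (hπ.W2_ne_zero hne) (W2_ne_top hfin)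
  obtain ⟨a, b, ha, -, hb, hab⟩ := hπ'.contains
  obtain ⟨α, hα, hα'⟩ := hab 0 (left_mem_Icc.2 zero_le_one)
  obtain ⟨β, hβ, hβ'⟩ := hab 1 (right_mem_Icc.2 zero_le_one)
  replace hα : α ∈ Icc (0 : ℝ) 1 := ⟨ha.trans hα.1, hα.2.trans hb⟩
  replace hβ : β ∈ Icc (0 : ℝ) 1 := ⟨ha.trans hβ.1, hβ.2.trans hb⟩
  rw [← hst, hπ'.optimal.regularizer_eq hπ'.finite hs, hst, hπ.regularizer_eq hfin ht]
  -- The two geodesics, parametrized by arc length, agree up to an isometry.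
  have speed {u u' v v' : ℝ} (hu : u ∈ Icc (0 : ℝ) 1) (hu' : u' ∈ Icc (0 : ℝ) 1)
      (hv : v ∈ Icc (0 : ℝ) 1) (hv' : v' ∈ Icc (0 : ℝ) 1) (h : interp π' u' = interp π u)
      (h' : interp π' v' = interp π v) :
      |v' * (W2 μ' ν').toReal - u' * (W2 μ' ν').toReal| = |v - u| * (W2 μ ν).toReal := by
    have e := hπ'.optimal.W2_interp hπ'.finite hu' hv'
    rw [h, h', hπ.W2_interp hfin hu hv,
      ENNReal.ofReal_eq_ofReal_iff (by positivity) (by positivity)] at e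
    rw [← sub_mul, abs_mul, abs_of_nonneg ENNReal.toReal_nonneg, e]
  have scale {u : ℝ} (hu : u ∈ Icc (0 : ℝ) 1) :
      u * (W2 μ' ν').toReal ∈ Icc 0 (W2 μ' ν').toReal :=
    ⟨mul_nonneg hu.1 ENNReal.toReal_nonneg, mul_le_of_le_one_left ENNReal.toReal_nonneg hu.2⟩
  have h0 : (0 : ℝ) ∈ Icc (0 : ℝ) 1 := left_mem_Icc.2 zero_le_one
  have h1 : (1 : ℝ) ∈ Icc (0 : ℝ) 1 := right_mem_Icc.2 zero_le_one
  have hAB := speed h0 hα h1 hβ hα' hβ'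
  have hAS := speed h0 hα ht hs hα' hst
  have hSB := speed ht hs h1 hβ hst hβ'
  rw [sub_zero, abs_one, one_mul] at hAB
  rw [sub_zero, abs_of_nonneg ht.1] at hAS
  rw [abs_of_nonneg (sub_nonneg.2 ht.2)] at hSB
  obtain ⟨hle, heq⟩ := mul_le_mul_of_geodesic hD ht (scale hα) (scale hβ) hAB hAS hSB
  rw [← one_sub_mul] at hle heq
  refine ⟨ENNReal.ofReal_le_ofReal hle, fun ht' hle' ↦ ?_⟩
  rw [ENNReal.ofReal_le_ofReal_iff (mul_nonneg (mul_nonneg ht.1 hD.le)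
    (mul_nonneg (sub_nonneg.2 ht.2) hD.le))] at hle'
  obtain ⟨hD', h⟩ := heq ht'.1 ht'.2 hle'
  rw [hD'] at h
  have cancel {u v : ℝ} (h : u * (W2 μ ν).toReal = v * (W2 μ ν).toReal) : u = v :=
    mul_right_cancel₀ hD.ne' h
  rcases h with ⟨hA, hB, hS⟩ | ⟨hA, hB, hS⟩
  · left
    obtain rfl : α = 0 := cancel (by rw [hA, zero_mul])
    obtain rfl : β = 1 := cancel (by rw [hB, one_mul])
    rw [hπ'.optimal.1.interp_zero, hπ.1.interp_zero] at hα'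
    rw [hπ'.optimal.1.interp_one, hπ.1.interp_one] at hβ'
    rw [hα', hβ', cancel hS]
  · right
    obtain rfl : α = 1 := cancel (by rw [hA, one_mul])
    obtain rfl : β = 0 := cancel (by rw [hB, zero_mul])
    rw [hπ'.optimal.1.interp_one, hπ.1.interp_zero] at hα'
    rw [hπ'.optimal.1.interp_zero, hπ.1.interp_one] at hβ'
    rw [hα', hβ', cancel hS]

theorem regularizer_swap (ρ : Measure (Rd d)) (μ ν : Measure (Rd d)) (t : ℝ) :
    regularizer ρ ((ν, μ), 1 - t) = regularizer ρ ((μ, ν), t) := by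
  simp only [regularizer, sub_sub_cancel]
  exact add_comm _ _

end McCann

theorem corollary1 (d : ℕ) (μ ν : Measure (McCann.Rd d))
    [IsProbabilityMeasure μ] [IsProbabilityMeasure ν] (hne : μ ≠ ν)
    (hfin : McCann.W2sq μ ν < ∞)
    (π : Measure (McCann.Rd d × McCann.Rd d)) (hπ : McCann.IsOptimalPlan π μ ν) :
    (∀ t ∈ Icc (0 : ℝ) 1,
      ((μ, ν), t) ∈
        McCann.argminSet (McCann.regularizer (McCann.interp π t)) (McCann.candidates π t)) ∧
    (∀ t ∈ Ioo (0 : ℝ) 1,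
      McCann.argminSet (McCann.regularizer (McCann.interp π t)) (McCann.candidates π t) =
        {((μ, ν), t), ((ν, μ), 1 - t)}) := by
  have hmin : ∀ t ∈ Icc (0 : ℝ) 1, ((μ, ν), t) ∈
      McCann.argminSet (McCann.regularizer (McCann.interp π t)) (McCann.candidates π t) := by
    refine fun t ht ↦ ⟨⟨π, hπ.isExtension_self hfin, ht, rfl⟩, ?_⟩
    rintro ⟨⟨μ', ν'⟩, s⟩ ⟨π', hext, hs, hst⟩
    exact (hext.regularizer_compare hne hfin hπ hs ht hst).1
  refine ⟨hmin, fun t ht ↦ Subset.antisymm ?_ ?_⟩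
  · rintro ⟨⟨μ', ν'⟩, s⟩ ⟨⟨π', hext, hs, hst⟩, hle⟩
    exact (hext.regularizer_compare hne hfin hπ hs (Ioo_subset_Icc_self ht) hst).2 ht
      (hle _ (hmin t (Ioo_subset_Icc_self ht)).1)
  · rintro q (rfl | rfl)
    · exact hmin t (Ioo_subset_Icc_self ht)
    · refine ⟨⟨_, hπ.isExtension_swap hfin, ⟨sub_nonneg.2 ht.2.le, sub_le_self _ ht.1.le⟩, ?_⟩, ?_⟩
      · rw [McCann.interp_swap, sub_sub_cancel]
      · rw [McCann.regularizer_swap]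
        exact (hmin t (Ioo_subset_Icc_self ht)).2
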